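/- Let $G$ be a finite simple graph on $n$ vertices. A vertex is \emph{totally dominated} by a set $A \subseteq V(G)$ if it has a neighbor in $A$. In the total domination game, Dominator and Staller alternately select vertices of $G$, Dominator moving first; each selected vertex must strictly increase the number of vertices that are totally dominated by the set of selected vertices, and the game stops when every vertex of $G$ is totally dominated by the set of selected vertices. Dominator wants to minimize, and Staller to maximize, the number of selected vertices at the end, and $\gamma_{tg}(G)$ denotes this number when both play optimally. \textbf{Theorem.} For every graph $G$ with minimum degree at least $2$, $$\gamma_{tg}(G) \le \frac{5}{7}\,n + \frac{5}{7}.$$ -/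

import Mathlib

namespace TotalDomination

/-- A vertex `u` is totally dominated by the set `A` if it has a neighbor in `A`. -/
def IsTotallyDominated {V : Type*} (G : SimpleGraph V) (A : Finset V) (u : V) : Prop :=
  ∃ a ∈ A, G.Adj a u

/-- The set of vertices that are totally dominated by `A`. -/
def dominatedSet {V : Type*} [Fintype V] (G : SimpleGraph V) [DecidableRel G.Adj]
    (A : Finset V) : Finset V :=
  {u | ∃ a ∈ A, G.Adj a u}

theorem mem_dominatedSet {V : Type*} [Fintype V] (G : SimpleGraph V) [DecidableRel G.Adj]
    (A : Finset V) (u : V) : u ∈ dominatedSet G A ↔ IsTotallyDominated G A u := by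
  simp [dominatedSet, IsTotallyDominated]

/-- The legal moves of the total domination game when the set of vertices selected so far is `A`:
the vertices whose selection strictly increases the number of totally dominated vertices. -/
def legalMoves {V : Type*} [Fintype V] [DecidableEq V] (G : SimpleGraph V) [DecidableRel G.Adj]
    (A : Finset V) : Finset V :=
  {v | (dominatedSet G A).card < (dominatedSet G (insert v A)).card}

theorem not_mem_of_mem_legalMoves {V : Type*} [Fintype V] [DecidableEq V] {G : SimpleGraph V}
    [DecidableRel G.Adj] {A : Finset V} {v : V} (hv : v ∈ legalMoves G A) : v ∉ A := by
  intro h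
  simp [legalMoves, Finset.insert_eq_of_mem h] at hv

theorem card_compl_insert_lt {V : Type*} [Fintype V] [DecidableEq V] {G : SimpleGraph V}
    [DecidableRel G.Adj] {A : Finset V} {v : V} (hv : v ∈ legalMoves G A) :
    ((insert v A)ᶜ).card < (Aᶜ).card := by
  apply Finset.card_lt_card
  have h := not_mem_of_mem_legalMoves hv
  refine Finset.ssubset_iff_of_subset ?_ |>.2 ⟨v, by simpa using h, by simp⟩
  exact Finset.compl_subset_compl.2 (Finset.subset_insert v A)

/-- The two players of the game. -/
inductive Player where
  | dominator
  | staller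

/-- The number of selected vertices at the end of the total domination game, when the set of
vertices selected so far is `A`, the given player is to move, and from now on both players play
optimally: Dominator minimizes and Staller maximizes this number. The game stops as soon as there
is no legal move; in a graph without isolated vertices this happens exactly when `A` is a total
dominating set (see `legalMoves_eq_empty_iff`). -/
def finalSize {V : Type*} [Fintype V] [DecidableEq V] (G : SimpleGraph V) [DecidableRel G.Adj]
    (p : Player) (A : Finset V) : ℕ :=
  if h : (legalMoves G A).attach.Nonempty then
    match p with
    | .dominator =>
        (legalMoves G A).attach.inf' h (fun v => finalSize G .staller (insert v.1 A))
    | .staller =>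
        (legalMoves G A).attach.sup' h (fun v => finalSize G .dominator (insert v.1 A))
  else A.card
termination_by (Aᶜ).card
decreasing_by
  all_goals exact card_compl_insert_lt v.2

theorem legalMoves_eq_empty_iff {V : Type*} [Fintype V] [DecidableEq V] (G : SimpleGraph V)
    [DecidableRel G.Adj] (hG : ∀ v, ∃ w, G.Adj v w) (A : Finset V) :
    legalMoves G A = ∅ ↔ ∀ u, IsTotallyDominated G A u := by
  constructor
  · intro h u
    by_contra hu
    obtain ⟨w, hw⟩ := hG u
    have hmem : w ∈ legalMoves G A := by
      simp only [legalMoves, Finset.mem_filter, Finset.mem_univ, true_and]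
      apply Finset.card_lt_card
      refine Finset.ssubset_iff_of_subset ?_ |>.2 ⟨u, ?_, ?_⟩
      · intro x hx
        rw [mem_dominatedSet] at hx ⊢
        obtain ⟨a, ha, hax⟩ := hx
        exact ⟨a, Finset.mem_insert_of_mem ha, hax⟩
      · rw [mem_dominatedSet]
        exact ⟨w, Finset.mem_insert_self w A, hw.symm⟩
      · rwa [mem_dominatedSet]
    simp [h] at hmem
  · intro h
    have h1 : dominatedSet G A = Finset.univ := by
      ext u
      simpa [mem_dominatedSet] using h u
    ext v
    simp only [legalMoves, h1, Finset.mem_filter, Finset.mem_univ, true_and, Finset.notMem_empty,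
      iff_false, not_lt]
    exact Finset.card_le_univ _

/-- The game total domination number `γ_tg(G)`: Dominator starts on the empty set. -/
def gameTotalDominationNumber {V : Type*} [Fintype V] [DecidableEq V] (G : SimpleGraph V)
    [DecidableRel G.Adj] : ℕ :=
  finalSize G .dominator ∅

end TotalDomination

namespace TotalDomination

/-! Charge 7 per move against `potential`, which is at most 5n at the start. A legal move that gains
g vertices pays at least 2g + 3, and 3 more for each other move it makes illegal. Minimum degree 2
gives every undominated vertex a second move gaining it. `dominatorBound` proves by induction over
pairs of moves that the charges exceed the potential by at most 5 when Dominator is to move, or 3 if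
gains are at most 2 and some gain is 1. The matching slack for Staller is 7, 5 under `GainLeTwo`,
and 4 if also `Separated`. -/

theorem exists_ne_adj_of_two_le_minDegree {V : Type*} [Fintype V] {G : SimpleGraph V}
    [DecidableRel G.Adj] (hG : 2 ≤ G.minDegree) (u w : V) : ∃ w', w' ≠ w ∧ G.Adj w' u := by
  have h : 1 < (G.neighborFinset u).card := by
    rw [G.card_neighborFinset_eq_degree]
    exact hG.trans (G.minDegree_le_degree u)
  obtain ⟨w', hw', hne⟩ := Finset.exists_mem_ne h w
  exact ⟨w', hne, ((G.mem_neighborFinset u w').1 hw').symm⟩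

variable {V : Type*} [Fintype V] [DecidableEq V] (G : SimpleGraph V) [DecidableRel G.Adj]

/-- The neighbors of `v` that are not totally dominated by `A`: what selecting `v` would gain. -/
def gain (A : Finset V) (v : V) : Finset V :=
  (dominatedSet G A)ᶜ.filter (fun u => G.Adj v u)

/-- Twice the number of undominated vertices plus three times the number of legal moves. -/
def potential (A : Finset V) : ℕ :=
  2 * (dominatedSet G A)ᶜ.card + 3 * (legalMoves G A).card

variable {G}

theorem mem_gain {A : Finset V} {v u : V} :
    u ∈ gain G A v ↔ (∀ a ∈ A, ¬ G.Adj a u) ∧ G.Adj v u := by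
  simp [gain, mem_dominatedSet, IsTotallyDominated]

theorem dominatedSet_insert (A : Finset V) (v : V) :
    dominatedSet G (insert v A) = dominatedSet G A ∪ gain G A v := by
  ext u
  simp only [mem_dominatedSet, IsTotallyDominated, Finset.mem_union, mem_gain,
    Finset.mem_insert, exists_eq_or_imp]
  by_cases h : ∃ a ∈ A, G.Adj a u
  · simp [h]
  · simp only [h, or_false, false_or]
    push Not at h
    simpa [h] using fun _ => h

theorem card_dominatedSet_insert (A : Finset V) (v : V) :
    (dominatedSet G (insert v A)).card = (dominatedSet G A).card + (gain G A v).card := by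
  rw [dominatedSet_insert, Finset.card_union_of_disjoint]
  rw [Finset.disjoint_left]
  intro u hu hg
  simp [gain, hu] at hg

theorem mem_legalMoves {A : Finset V} {v : V} :
    v ∈ legalMoves G A ↔ 1 ≤ (gain G A v).card := by
  simp only [legalMoves, Finset.mem_filter, Finset.mem_univ, true_and, card_dominatedSet_insert]
  omega

theorem mem_legalMoves_of_mem_gain {A : Finset V} {v u : V} (h : u ∈ gain G A v) :
    v ∈ legalMoves G A :=
  mem_legalMoves.2 (Finset.card_pos.2 ⟨u, h⟩)

theorem gain_insert (A : Finset V) (v w : V) :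
    gain G (insert v A) w = gain G A w \ gain G A v := by
  ext u
  simp only [mem_gain, Finset.mem_insert, forall_eq_or_imp, Finset.mem_sdiff]
  tauto

theorem gain_insert_subset (A : Finset V) (v w : V) :
    gain G (insert v A) w ⊆ gain G A w := by
  rw [gain_insert]
  exact Finset.sdiff_subset

theorem legalMoves_insert_subset (A : Finset V) (v : V) :
    legalMoves G (insert v A) ⊆ legalMoves G A := by
  intro w hw
  rw [mem_legalMoves] at hw ⊢
  exact hw.trans (Finset.card_le_card (gain_insert_subset A v w))

/-- Selecting `v` lowers the potential by `2` for each vertex gained and by `3` for each move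
in a set `S` of moves which lose their legality. -/
theorem potential_insert_add_le {A : Finset V} {v : V} {S : Finset V}
    (hS : S ⊆ legalMoves G A) (hSv : ∀ w ∈ S, gain G A w ⊆ gain G A v) :
    potential G (insert v A) + 2 * (gain G A v).card + 3 * S.card ≤ potential G A := by
  have h1 : (legalMoves G (insert v A)).card + S.card ≤ (legalMoves G A).card := by
    rw [← Finset.card_union_of_disjoint]
    · exact Finset.card_le_card (Finset.union_subset (legalMoves_insert_subset A v) hS)
    · rw [Finset.disjoint_right]
      intro w hw hl
      rw [mem_legalMoves, gain_insert, Finset.sdiff_eq_empty_iff_subset.2 (hSv w hw)] at hl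
      simp at hl
  have h2 := card_dominatedSet_insert (G := G) A v
  have h3 := Finset.card_compl_add_card (dominatedSet G A)
  have h4 := Finset.card_compl_add_card (dominatedSet G (insert v A))
  simp only [potential]
  omega

theorem potential_insert_add_le_of_mem {A : Finset V} {v : V} (hv : v ∈ legalMoves G A) :
    potential G (insert v A) + 2 * (gain G A v).card + 3 ≤ potential G A := by
  simpa using potential_insert_add_le (S := {v}) (by simpa using hv) (by simp)

theorem potential_insert_add_le_of_ne {A : Finset V} {v w : V} (hv : v ∈ legalMoves G A)
    (hw : w ∈ legalMoves G A) (hne : w ≠ v) (hwv : gain G A w ⊆ gain G A v) :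
    potential G (insert v A) + 2 * (gain G A v).card + 6 ≤ potential G A := by
  have h := potential_insert_add_le (G := G) (A := A) (v := v) (S := {w, v})
    (by simp [Finset.insert_subset_iff, hv, hw]) (by simpa using hwv)
  rwa [Finset.card_pair hne] at h

/-! ### Unfolding the recursive game value -/

theorem finalSize_of_legalMoves_eq_empty (p : Player) {A : Finset V} (h : legalMoves G A = ∅) :
    finalSize G p A = A.card := by
  rw [finalSize, dif_neg]
  simp [h]

theorem finalSize_dominator_le {A : Finset V} {v : V} (hv : v ∈ legalMoves G A) :
    finalSize G .dominator A ≤ finalSize G .staller (insert v A) := by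
  rw [finalSize, dif_pos ⟨⟨v, hv⟩, Finset.mem_attach _ _⟩]
  exact Finset.inf'_le (fun w : {x // x ∈ legalMoves G A} => finalSize G .staller (insert w.1 A))
    (Finset.mem_attach _ ⟨v, hv⟩)

theorem exists_finalSize_staller_le {A : Finset V} (h : (legalMoves G A).Nonempty) :
    ∃ v ∈ legalMoves G A, finalSize G .staller A ≤ finalSize G .dominator (insert v A) := by
  have h' : (legalMoves G A).attach.Nonempty := by simpa using h
  rw [finalSize, dif_pos h']
  obtain ⟨v, -, hv⟩ := Finset.exists_mem_eq_sup' h'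
    (fun w : {x // x ∈ legalMoves G A} => finalSize G .dominator (insert w.1 A))
  exact ⟨v.1, v.2, hv.le⟩

theorem finalSize_staller_le_of_forall {A : Finset V} {c : ℕ} (h0 : 7 * A.card ≤ c)
    (h : ∀ v ∈ legalMoves G A, 7 * finalSize G .dominator (insert v A) ≤ c) :
    7 * finalSize G .staller A ≤ c := by
  rcases (legalMoves G A).eq_empty_or_nonempty with he | hne
  · rwa [finalSize_of_legalMoves_eq_empty _ he]
  · obtain ⟨v, hv, hle⟩ := exists_finalSize_staller_le hne
    have := h v hv
    omega

/-- No move gains more than two vertices. -/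
def GainLeTwo (G : SimpleGraph V) [DecidableRel G.Adj] (A : Finset V) : Prop :=
  ∀ v, (gain G A v).card ≤ 2

theorem GainLeTwo.insert {A : Finset V} (h : GainLeTwo G A) (v : V) :
    GainLeTwo G (insert v A) :=
  fun w => (Finset.card_le_card (gain_insert_subset A v w)).trans (h w)

/-- No vertex is gained both by a move with a single gain and by a move with at least two. -/
def Separated (G : SimpleGraph V) [DecidableRel G.Adj] (A : Finset V) : Prop :=
  ∀ v w u, u ∈ gain G A v → u ∈ gain G A w → (gain G A v).card = 1 → (gain G A w).card = 1

/-- The bounds on the length of the game from a position with Dominator to move. -/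
def DominatorBound (G : SimpleGraph V) [DecidableRel G.Adj] (A : Finset V) : Prop :=
  7 * finalSize G .dominator A ≤ 7 * A.card + potential G A + 5 ∧
    (GainLeTwo G A → (∃ v, (gain G A v).card = 1) →
      7 * finalSize G .dominator A ≤ 7 * A.card + potential G A + 3)

theorem card_insert_of_mem_legalMoves {A : Finset V} {v : V} (hv : v ∈ legalMoves G A) :
    (insert v A).card = A.card + 1 :=
  Finset.card_insert_of_notMem (not_mem_of_mem_legalMoves hv)

/-- Staller's cheapest move pays 2 + 3 = 5, so the slack 5 grows by 2. -/
theorem finalSize_staller_le {A : Finset V}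
    (ih : ∀ v ∈ legalMoves G A, DominatorBound G (insert v A)) :
    7 * finalSize G .staller A ≤ 7 * A.card + potential G A + 7 := by
  refine finalSize_staller_le_of_forall (by omega) fun v hv => ?_
  have h1 := (ih v hv).1
  have h2 := potential_insert_add_le_of_mem hv
  have h3 := mem_legalMoves.1 hv
  rw [card_insert_of_mem_legalMoves hv] at h1
  omega

theorem exists_ne_mem_gain (hG : ∀ u w, G.Adj w u → ∃ w', w' ≠ w ∧ G.Adj w' u)
    {A : Finset V} {u w : V} (h : u ∈ gain G A w) : ∃ w', w' ≠ w ∧ u ∈ gain G A w' := by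
  rw [mem_gain] at h
  obtain ⟨w', hne, hw'⟩ := hG u w h.2
  exact ⟨w', hne, mem_gain.2 ⟨h.1, hw'⟩⟩

/-- A second move `w` that shares a vertex with `v` either becomes illegal once `v` is selected,
or is left with a single gain. -/
theorem gain_subset_or_card_gain_insert_eq_one {A : Finset V} (h2 : GainLeTwo G A) {u v w : V}
    (hv : u ∈ gain G A v) (hw : u ∈ gain G A w) :
    gain G A w ⊆ gain G A v ∨ (gain G (insert v A) w).card = 1 := by
  rw [or_iff_not_imp_left, gain_insert]
  intro hns
  have h1 : (gain G A w \ gain G A v).card < (gain G A w).card :=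
    Finset.card_lt_card (Finset.ssubset_iff_of_subset Finset.sdiff_subset |>.2
      ⟨u, hw, by simp [hv]⟩)
  have h3 : 0 < (gain G A w \ gain G A v).card := by
    rw [Finset.card_pos, Finset.sdiff_nonempty]
    exact hns
  have h4 := h2 w
  omega

/-- Staller's move either kills a second move, paying at least 8, or leaves a single gain, which
gives Dominator the slack 3. -/
theorem finalSize_staller_le_of_gainLeTwo
    (hG : ∀ u w, G.Adj w u → ∃ w', w' ≠ w ∧ G.Adj w' u) {A : Finset V} (hA : GainLeTwo G A)
    (ih : ∀ v ∈ legalMoves G A, DominatorBound G (insert v A)) :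
    7 * finalSize G .staller A ≤ 7 * A.card + potential G A + 5 := by
  refine finalSize_staller_le_of_forall (by omega) fun v hv => ?_
  obtain ⟨h1, h1'⟩ := ih v hv
  have h2 := potential_insert_add_le_of_mem hv
  have h3 := mem_legalMoves.1 hv
  rw [card_insert_of_mem_legalMoves hv] at h1 h1'
  obtain ⟨u, hu⟩ := Finset.card_pos.1 h3
  obtain ⟨w, hne, hw⟩ := exists_ne_mem_gain hG hu
  rcases gain_subset_or_card_gain_insert_eq_one hA hu hw with h | h
  · have := potential_insert_add_le_of_ne hv (mem_legalMoves_of_mem_gain hw) hne h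
    omega
  · have := h1' (hA.insert v) ⟨w, h⟩
    omega

theorem finalSize_staller_le_of_separated
    (hG : ∀ u w, G.Adj w u → ∃ w', w' ≠ w ∧ G.Adj w' u) {A : Finset V} (hA : GainLeTwo G A)
    (hs : Separated G A) (ih : ∀ v ∈ legalMoves G A, DominatorBound G (insert v A)) :
    7 * finalSize G .staller A ≤ 7 * A.card + potential G A + 4 := by
  refine finalSize_staller_le_of_forall (by omega) fun v hv => ?_
  obtain ⟨h1, h1'⟩ := ih v hv
  have h2 := potential_insert_add_le_of_mem hv
  have h3 := mem_legalMoves.1 hv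
  rw [card_insert_of_mem_legalMoves hv] at h1 h1'
  obtain ⟨u, hu⟩ := Finset.card_pos.1 h3
  obtain ⟨w, hne, hw⟩ := exists_ne_mem_gain hG hu
  rcases gain_subset_or_card_gain_insert_eq_one hA hu hw with h | h
  · have := potential_insert_add_le_of_ne hv (mem_legalMoves_of_mem_gain hw) hne h
    omega
  · have h4 := h1' (hA.insert v) ⟨w, h⟩
    -- If `v` gained only `u`, separation would force the same of `w`, leaving `w` no gain. So `v`
    -- pays at least 7.
    have h5 : (gain G A v).card ≠ 1 := by
      intro h5
      have h6 := hs v w u hu hw h5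
      have h7 : gain G A w = {u} := by
        obtain ⟨x, hx⟩ := Finset.card_eq_one.1 h6
        rw [hx, Finset.mem_singleton] at hw
        rw [hx, hw]
      rw [gain_insert, h7, Finset.sdiff_eq_empty_iff_subset.2 (by simpa using hu)] at h
      simp at h
    omega

theorem Separated.insert {A : Finset V} (hs : Separated G A) {v : V}
    (hv : (gain G A v).card = 1) : Separated G (insert v A) := by
  -- By separation, a move sharing the single vertex of `v` gains nothing else and dies; every
  -- surviving move keeps its whole gain.
  have key : ∀ w u, u ∈ gain G (Insert.insert v A) w →
      gain G (Insert.insert v A) w = gain G A w := by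
    intro w u hu
    rw [gain_insert] at hu ⊢
    rw [Finset.sdiff_eq_self_iff_disjoint, Finset.disjoint_left]
    intro x hxw hxv
    have h1 := hs v w x hxv hxw hv
    obtain ⟨y, hy⟩ := Finset.card_eq_one.1 h1
    rw [hy] at hu hxw
    simp only [Finset.mem_sdiff, Finset.mem_singleton] at hu hxw
    exact hu.2 (by rw [hu.1, ← hxw]; exact hxv)
  intro x w u hx hw h1
  rw [key x u hx] at h1
  rw [key w u hw]
  exact hs x w u (gain_insert_subset A v x hx) (gain_insert_subset A v w hw) h1

theorem dominatorBound (hG : ∀ u w, G.Adj w u → ∃ w', w' ≠ w ∧ G.Adj w' u) (A : Finset V) :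
    DominatorBound G A := by
  have ih : ∀ v ∈ legalMoves G A, ∀ w ∈ legalMoves G (insert v A),
      DominatorBound G (insert w (insert v A)) := fun v hv w hw =>
    dominatorBound hG _
  by_cases h2 : GainLeTwo G A
  · by_cases h1 : ∃ v, (gain G A v).card = 1
    · suffices h : 7 * finalSize G .dominator A ≤ 7 * A.card + potential G A + 3 from
        ⟨by omega, fun _ _ => h⟩
      by_cases hs : Separated G A
      -- A single gain also kills its twin `w`: it pays 8, and 7 + 4 - 8 = 3.
      · obtain ⟨v, hv⟩ := h1
        have hvl : v ∈ legalMoves G A := mem_legalMoves.2 hv.ge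
        obtain ⟨u, hu⟩ := Finset.card_pos.1 (mem_legalMoves.1 hvl)
        obtain ⟨w, hne, hw⟩ := exists_ne_mem_gain hG hu
        have hwv : gain G A w ⊆ gain G A v := by
          obtain ⟨x, hx⟩ := Finset.card_eq_one.1 (hs v w u hu hw hv)
          rw [hx, Finset.mem_singleton] at hw
          simpa [hx, ← hw] using hu
        have h3 := potential_insert_add_le_of_ne hvl (mem_legalMoves_of_mem_gain hw) hne hwv
        have h4 := finalSize_staller_le_of_separated hG (h2.insert v) (hs.insert hv) (ih v hvl)
        have h5 := finalSize_dominator_le hvl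
        rw [card_insert_of_mem_legalMoves hvl] at h4
        omega
      -- A double gain that absorbs a single one pays 4 + 6 = 10, and 7 + 5 - 10 = 2.
      · simp only [Separated, not_forall] at hs
        obtain ⟨w, v, u, hw, hv, hw1, hv1⟩ := hs
        have hvl := mem_legalMoves_of_mem_gain hv
        have hv2 := mem_legalMoves.1 hvl
        have hwv : gain G A w ⊆ gain G A v := by
          obtain ⟨x, hx⟩ := Finset.card_eq_one.1 hw1
          rw [hx, Finset.mem_singleton] at hw
          simpa [hx, ← hw] using hv
        have hne : w ≠ v := by
          rintro rfl
          exact hv1 hw1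
        have h3 := potential_insert_add_le_of_ne hvl (mem_legalMoves_of_mem_gain hw) hne hwv
        have h4 := finalSize_staller_le_of_gainLeTwo hG (h2.insert v) (ih v hvl)
        have h5 := finalSize_dominator_le hvl
        rw [card_insert_of_mem_legalMoves hvl] at h4
        omega
    · refine ⟨?_, fun _ h => absurd h h1⟩
      rcases (legalMoves G A).eq_empty_or_nonempty with he | ⟨v, hvl⟩
      · rw [finalSize_of_legalMoves_eq_empty _ he]
        omega
      -- Every legal move gains exactly 2 and pays 7.
      · have hv1 : (gain G A v).card ≠ 1 := fun h => h1 ⟨v, h⟩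
        have hv2 := mem_legalMoves.1 hvl
        have h3 := potential_insert_add_le_of_mem hvl
        have h4 := finalSize_staller_le_of_gainLeTwo hG (h2.insert v) (ih v hvl)
        have h5 := finalSize_dominator_le hvl
        rw [card_insert_of_mem_legalMoves hvl] at h4
        omega
  · refine ⟨?_, fun h => absurd h h2⟩
    simp only [GainLeTwo, not_forall, not_le] at h2
    obtain ⟨v, hv⟩ := h2
    -- A gain of at least 3 pays 9, and 7 + 7 - 9 = 5.
    have hvl : v ∈ legalMoves G A := mem_legalMoves.2 (by omega)
    have h3 := potential_insert_add_le_of_mem hvl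
    have h4 := finalSize_staller_le (ih v hvl)
    have h5 := finalSize_dominator_le hvl
    rw [card_insert_of_mem_legalMoves hvl] at h4
    omega
termination_by (Aᶜ).card
decreasing_by exact (card_compl_insert_lt hw).trans (card_compl_insert_lt hv)

theorem potential_le (A : Finset V) : potential G A ≤ 5 * Fintype.card V := by
  have h1 := Finset.card_le_univ (dominatedSet G A)ᶜ
  have h2 := Finset.card_le_univ (legalMoves G A)
  simp only [potential]
  omega

end TotalDomination

theorem mainTheorem2 {V : Type*} [Fintype V] [DecidableEq V] (G : SimpleGraph V)
    [DecidableRel G.Adj] (hG : 2 ≤ G.minDegree) :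
    (TotalDomination.gameTotalDominationNumber G : ℝ) ≤ 5 / 7 * (Fintype.card V : ℝ) + 5 / 7 := by
  have h1 := (TotalDomination.dominatorBound
    (fun u w _ => TotalDomination.exists_ne_adj_of_two_le_minDegree hG u w) ∅).1
  have h2 := TotalDomination.potential_le (G := G) ∅
  have h3 : 7 * TotalDomination.gameTotalDominationNumber G ≤ 5 * Fintype.card V + 5 := by
    rw [TotalDomination.gameTotalDominationNumber]
    simp only [Finset.card_empty] at h1
    omega
  have h4 : (7 * TotalDomination.gameTotalDominationNumber G : ℝ) ≤ 5 * Fintype.card V + 5 := by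
    exact_mod_cast h3
  linarith
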